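/- Let $c=(c_1,c_2)\in\mathbb{C}^2$, and let $f:\mathbb{C}^2\to\mathbb{C}$ be a transcendental entire function (entire and not a polynomial) of finite order, i.e. $\limsup_{r\to\infty}\frac{\log^+\log^+ M(r,f)}{\log r}<\infty$ with $M(r,f)=\max_{|z_1|^2+|z_2|^2\le r^2}|f(z_1,z_2)|$, satisfying $$\left(\frac{\partial f}{\partial z_1}(z_1,z_2)\right)^2+f(z_1+c_1,z_2+c_2)^2=1\qquad\text{for all }(z_1,z_2)\in\mathbb{C}^2 .$$ Then there are complex constants $A,B,\alpha,\beta_1,\beta_2$ with $A^2=1$, $\alpha\neq0$, $\beta_1\beta_2=1$, and a polynomial $h$ in one variable with complex coefficients such that for all $(z_1,z_2)\in\mathbb{C}^2$ $$f(z_1,z_2)=\frac{A}{2i}\left(\beta_1e^{\alpha\left(\frac{i}{\alpha}Az_1+Bz_2+h(z_2)\right)}-\beta_2e^{-\alpha\left(\frac{i}{\alpha}Az_1+Bz_2+h(z_2)\right)}\right),$$ and $$h(z_2)-h(z_2+c_2)=\frac{i}{\alpha}Ac_1+Bc_2+\frac{1}{\alpha}\log A\quad\text{for all }z_2\in\mathbb{C},\qquad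 Ae^{iAc_1+\alpha Bc_2}=1,$$ where $\log A$ denotes some value of the complex logarithm of $A$ (some $\ell\in\mathbb{C}$ with $e^{\ell}=A$). Moreover, if $c_2\neq0$, these can be chosen so that $h$ is a constant $C$, and then $$f(z_1,z_2)=\frac{A}{2i}\left(\beta_1e^{\alpha\left(\frac{i}{\alpha}Az_1+Bz_2+C\right)}-\beta_2e^{-\alpha\left(\frac{i}{\alpha}Az_1+Bz_2+C\right)}\right).$$ -/

import Mathlib

/-- The maximum modulus `M(r, f)` of `f : ℂ² → ℂ` over the closed Euclidean ball of radius `r`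
about the origin. (For continuous `f` the set is bounded, and for `r ≥ 0` it is non-empty.) -/
noncomputable def maxModulus (f : ℂ × ℂ → ℂ) (r : ℝ) : ℝ :=
  sSup {x : ℝ | ∃ z : ℂ × ℂ, ‖z.1‖ ^ 2 + ‖z.2‖ ^ 2 ≤ r ^ 2 ∧ x = ‖f z‖}

/-- The order of growth of an entire function on `ℂ²`,
`ρ(f) = limsup_{r → ∞} log⁺ log⁺ M(r, f) / log r`, as an extended real number. -/
noncomputable def growthOrder (f : ℂ × ℂ → ℂ) : EReal :=
  Filter.limsup
    (fun r : ℝ => ((Real.posLog (Real.posLog (maxModulus f r)) / Real.log r : ℝ) : EReal))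
    Filter.atTop

/-- `f` has finite order. (The order is never negative, so only `⊤` has to be excluded.) -/
def HasFiniteOrder (f : ℂ × ℂ → ℂ) : Prop :=
  growthOrder f < ⊤

/-- A function on `ℂ²` that is given by a polynomial in the two coordinates. -/
def IsPolynomialFun (f : ℂ × ℂ → ℂ) : Prop :=
  ∃ P : MvPolynomial (Fin 2) ℂ, ∀ z₁ z₂ : ℂ, f (z₁, z₂) = MvPolynomial.eval ![z₁, z₂] P

/-- A transcendental entire function on `ℂ²`: holomorphic on all of `ℂ²` and not a polynomial. -/
def IsTranscendentalEntire (f : ℂ × ℂ → ℂ) : Prop :=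
  Differentiable ℂ f ∧ ¬ IsPolynomialFun f

/-- The partial derivative `∂f/∂z₁` at `(z₁, z₂)`. -/
noncomputable def partialFst (f : ℂ × ℂ → ℂ) (z₁ z₂ : ℂ) : ℂ :=
  deriv (fun w : ℂ => f (w, z₂)) z₁

/-! Fix `z₂` and use the equation at `(z₁, z₂)` and at its translate by `c`. With `φ = f(·, z₂)` and
`ψ = f(· + c₁, z₂ + c₂)`, the factorization `(φ' + iψ)(φ' - iψ) = 1` has zero-free factors of finite
order, hence `φ' = cosh P`, `ψ = -i sinh P` with `P` a polynomial. The translated equation gives `ψ'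
= cosh Q`, so `P' cosh P = i cosh Q`. Borel's theorem on exponentials of polynomials then forces `P'
= iA` with `A ∈ {0, 1, -1}`.

So every slice is `2π`-periodic in `z₁`. If `A = 0`, then `φ` is affine and periodic, which makes
the slice `ψ` a constant `±1`. Being `π`-periodic and being `π`-antiperiodic are closed, mutually
exclusive conditions on the slice, so connectedness selects one of them for all slices; the periodic
one would make `f` a constant. In the antiperiodic case `f(z) - A f(z + c)` does not depend on `z₁`,
so it vanishes, and `A` is the same on all slices.

Finally `f(z₁ + π/2, z₂) + iA f(z₁, z₂)` is a pure exponential. At `z₁ = 0` it is zero-free of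
finite order in `z₂`, so its phase may be taken to be a polynomial `g`. The translation rule makes
`g(z₂ + c₂) - g(z₂)` constant, and `g` is affine when `c₂ ≠ 0`. -/

/-! ### Borel's theorem for polynomial exponents -/

-- Degree count: if `a ≠ 0`, the term with `Q'` has degree at least that of `a * c`, the other two
-- have less. Up to the factor `c ^ 2 * exp (-Q)`, the left side is the derivative of `(a / c) * exp
-- Q`.
open Polynomial in
theorem eq_zero_of_wronskian_add_eq_zero {a c Q : ℂ[X]} (hc : c ≠ 0) (hQ : derivative Q ≠ 0)
    (h : derivative a * c - a * derivative c + a * c * derivative Q = 0) : a = 0 := by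
  by_contra ha
  have h1 : (derivative a * c).degree < (a * c).degree := by
    rw [degree_mul, degree_mul]
    exact WithBot.add_lt_add_right (by simpa [degree_eq_bot] using hc) (degree_derivative_lt ha)
  have h2 : (a * derivative c).degree < (a * c).degree := by
    rw [degree_mul, degree_mul]
    exact WithBot.add_lt_add_left (by simpa [degree_eq_bot] using ha) (degree_derivative_lt hc)
  have h3 : (a * c).degree ≤ (a * c * derivative Q).degree := degree_le_mul_left _ hQ
  have h4 : a * c * derivative Q = a * derivative c - derivative a * c := by linear_combination h
  rw [h4] at h3
  exact absurd (h3.trans (degree_sub_le _ _)) (not_le.2 (max_lt h2 h1))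

open Polynomial in
/-- **Borel theorem** for polynomial exponents: exponentials of polynomials whose pairwise
differences are nonconstant are linearly independent over the polynomials. -/
theorem eq_zero_of_sum_eval_mul_exp_eq_zero {ι : Type*} [DecidableEq ι] (s : Finset ι)
    (P : ι → ℂ[X]) (hP : ∀ i ∈ s, ∀ j ∈ s, i ≠ j → derivative (P i - P j) ≠ 0) (a : ι → ℂ[X])
    (h : ∀ z, ∑ i ∈ s, (a i).eval z * Complex.exp ((P i).eval z) = 0) :
    ∀ i ∈ s, a i = 0 := by
  induction s using Finset.induction_on generalizing a with
  | empty => simp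
  | insert i s his ih =>
    have hP' : ∀ i ∈ s, ∀ j ∈ s, i ≠ j → derivative (P i - P j) ≠ 0 := fun k hk j hj =>
      hP k (Finset.mem_insert_of_mem hk) j (Finset.mem_insert_of_mem hj)
    have key : a i = 0 := by
      by_contra hai
      -- Divide the relation by its `i`-th term and differentiate: that term disappears, and these
      -- are the new coefficients after clearing `a i ^ 2`.
      have hb := ih hP' (fun j => derivative (a j) * a i - a j * derivative (a i)
          + a j * a i * derivative (P j - P i)) (fun z => by
        have hd : ∀ j, HasDerivAt (fun z => (a j).eval z * Complex.exp ((P j).eval z))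
            ((derivative (a j)).eval z * Complex.exp ((P j).eval z)
              + (a j).eval z * (Complex.exp ((P j).eval z) * (derivative (P j)).eval z)) z :=
          fun j => ((a j).hasDerivAt z).mul ((P j).hasDerivAt z).cexp
        have hD := HasDerivAt.fun_sum (u := insert i s) (fun j _ => hd j)
        have h0 : (fun z => ∑ j ∈ insert i s, (a j).eval z * Complex.exp ((P j).eval z))
            = fun _ => 0 := funext h
        rw [h0] at hD
        have hS' := hD.unique (hasDerivAt_const z (0 : ℂ))
        have hS := h z
        have hcomb : ∑ j ∈ insert i s, (derivative (a j) * a i - a j * derivative (a i)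
          + a j * a i * derivative (P j - P i)).eval z * Complex.exp ((P j).eval z) = 0 := by
          calc _ = (a i).eval z * (∑ j ∈ insert i s,
                ((derivative (a j)).eval z * Complex.exp ((P j).eval z)
                + (a j).eval z * (Complex.exp ((P j).eval z) * (derivative (P j)).eval z)))
              - ((derivative (a i)).eval z + (a i).eval z * (derivative (P i)).eval z) *
                ∑ j ∈ insert i s, (a j).eval z * Complex.exp ((P j).eval z) := by
                rw [Finset.mul_sum, Finset.mul_sum, ← Finset.sum_sub_distrib]
                refine Finset.sum_congr rfl fun j _ => ?_
                simp only [eval_add, eval_sub, eval_mul, derivative_sub]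
                ring
            _ = 0 := by rw [hS, hS']; ring
        rw [Finset.sum_insert his] at hcomb
        simpa [mul_comm] using hcomb)
      have ha : ∀ j ∈ s, a j = 0 := fun j hj =>
        eq_zero_of_wronskian_add_eq_zero hai
          (hP j (Finset.mem_insert_of_mem hj) i (Finset.mem_insert_self _ _)
            (fun e => his (e ▸ hj))) (hb j hj)
      apply hai
      refine Polynomial.funext fun z => ?_
      have := h z
      rw [Finset.sum_insert his, Finset.sum_eq_zero (fun j hj => by simp [ha j hj])] at this
      simpa using this
    intro j hj
    rcases Finset.mem_insert.1 hj with rfl | hj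
    · exact key
    · refine ih hP' a (fun z => ?_) j hj
      have := h z
      rw [Finset.sum_insert his] at this
      simpa [key] using this

/-! ### Entire functions of finite order in one variable -/

/-- A bound `‖g w‖ ≤ exp (r ^ K)` on all large discs `‖w‖ ≤ r`, i.e. finite order of growth. -/
def HasExpGrowth (g : ℂ → ℂ) : Prop :=
  ∃ K : ℕ, ∀ᶠ r : ℝ in Filter.atTop, ∀ w, ‖w‖ ≤ r → ‖g w‖ ≤ Real.exp (r ^ K)

/-- An entire function with no zeros has an entire logarithm. -/
theorem exists_entire_log {g : ℂ → ℂ} (hg : Differentiable ℂ g) (h0 : ∀ z, g z ≠ 0) :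
    ∃ p : ℂ → ℂ, Differentiable ℂ p ∧ ∀ z, g z = Complex.exp (p z) := by
  obtain ⟨L, hL0, hL⟩ := (Differentiable.isExactOn_univ
    (f := fun z => deriv g z / g z) (hg.deriv.div hg h0)).with_val_at 0 (Complex.log (g 0))
  have hL' : ∀ z, HasDerivAt L (deriv g z / g z) z := fun z => hL z (Set.mem_univ z)
  have hd : ∀ z, HasDerivAt (fun z => g z * Complex.exp (-L z)) 0 z := fun z => by
    have := (hg z).hasDerivAt.mul (hL' z).neg.cexp
    convert! this using 1
    have := h0 z
    field_simp
    ring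
  refine ⟨L, fun z => (hL' z).differentiableAt, fun z => ?_⟩
  have := is_const_of_deriv_eq_zero (fun z => (hd z).differentiableAt) (fun z => (hd z).deriv) z 0
  simp only [hL0, Complex.exp_neg, Complex.exp_log (h0 0), mul_inv_cancel₀ (h0 0)] at this
  field_simp at this
  exact this

/-- An entire function bounded by `C * r ^ K` on all large circles is a polynomial. -/
theorem exists_polynomial_of_growth {p : ℂ → ℂ} (hp : Differentiable ℂ p) {K : ℕ} {C : ℝ}
    (h : ∀ᶠ r : ℝ in Filter.atTop, ∀ w, ‖w‖ = r → ‖p w‖ ≤ C * r ^ K) :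
    ∃ P : Polynomial ℂ, ∀ z, p z = P.eval z := by
  have hvan : ∀ n, K < n → iteratedDeriv n p 0 = 0 := by
    intro n hn
    have hev : ∀ᶠ r : ℝ in Filter.atTop,
        ‖iteratedDeriv n p 0‖ ≤ n.factorial * C * r⁻¹ ^ (n - K) := by
      filter_upwards [h, Filter.eventually_gt_atTop 0] with r hr hr0
      have := Complex.norm_iteratedDeriv_le_of_forall_mem_sphere_norm_le (c := 0) n hr0
        hp.diffContOnCl (fun z hz => hr z (by simpa using hz))
      refine this.trans_eq ?_
      obtain ⟨m, rfl⟩ := Nat.exists_eq_add_of_lt hn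
      have : K + m + 1 - K = m + 1 := by omega
      rw [this, inv_pow]
      field_simp
      ring
    have hlim : Filter.Tendsto (fun r : ℝ => n.factorial * C * r⁻¹ ^ (n - K)) Filter.atTop
        (nhds 0) := by
      have := (tendsto_inv_atTop_zero (𝕜 := ℝ)).pow (n - K) |>.const_mul (n.factorial * C)
      simpa [zero_pow (Nat.sub_ne_zero_of_lt hn)] using this
    exact norm_le_zero_iff.1 (ge_of_tendsto hlim hev)
  refine ⟨∑ n ∈ Finset.range (K + 1),
    Polynomial.C ((n.factorial : ℂ)⁻¹ * iteratedDeriv n p 0) * Polynomial.X ^ n, fun z => ?_⟩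
  rw [← Complex.taylorSeries_eq_of_entire' 0 z hp, tsum_eq_sum (s := Finset.range (K + 1))]
  · simp [Polynomial.eval_finsetSum]
  · intro n hn
    rw [hvan n (by simpa using hn)]
    simp

/-- A zero-free entire function of finite order is the exponential of a polynomial. -/
theorem HasExpGrowth.exists_eq_exp_polynomial {g : ℂ → ℂ} (hg : Differentiable ℂ g)
    (h0 : ∀ z, g z ≠ 0) (hgr : HasExpGrowth g) :
    ∃ P : Polynomial ℂ, ∀ z, g z = Complex.exp (P.eval z) := by
  obtain ⟨p, hp, hgp⟩ := exists_entire_log hg h0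
  obtain ⟨K, hK⟩ := hgr
  -- Borel–Carathéodory on the disc of radius `2r`, where `Re p = log ‖g‖ ≤ (2r) ^ K`.
  have hbound : ∀ᶠ r : ℝ in Filter.atTop, ∀ w, ‖w‖ = r →
      ‖p w‖ ≤ (2 * 2 ^ K + 3 * ‖p 0‖) * r ^ K := by
    have h2 := (Filter.tendsto_id.const_mul_atTop (two_pos (α := ℝ))).eventually hK
    filter_upwards [h2, Filter.eventually_ge_atTop 1] with r hr hr1 w hw
    have hM : (0 : ℝ) < (2 * r) ^ K := by positivity
    have := Complex.borelCaratheodory (R := 2 * r) (z := w) hM hp.differentiableOn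
      (fun z hz => by
        have := hr z (by simpa using le_of_lt (by simpa using hz))
        rw [hgp, Complex.norm_exp] at this
        simpa using Real.exp_le_exp.1 this) (by linarith) (by simp [hw]; linarith)
    rw [hw] at this
    have e : 2 * (2 * r) ^ K * r / (2 * r - r) + ‖p 0‖ * (2 * r + r) / (2 * r - r)
        = 2 * 2 ^ K * r ^ K + 3 * ‖p 0‖ := by
      have : 2 * r - r = r := by ring
      rw [this, mul_pow]
      field_simp
      ring
    rw [e] at this
    refine this.trans ?_
    rw [add_mul]
    exact add_le_add le_rfl (le_mul_of_one_le_right (by positivity) (one_le_pow₀ hr1))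
  obtain ⟨P, hP⟩ := exists_polynomial_of_growth hp hbound
  exact ⟨P, fun z => by rw [hgp, hP]⟩

theorem HasExpGrowth.of_norm_le {g u v : ℂ → ℂ} (hu : HasExpGrowth u) (hv : HasExpGrowth v)
    (h : ∀ w, ‖g w‖ ≤ 1 + ‖u w‖ + ‖v w‖) : HasExpGrowth g := by
  obtain ⟨K, hK⟩ := hu
  obtain ⟨N, hN⟩ := hv
  -- The extra `2` in the exponent absorbs the factor `3 ≤ exp 2` coming from the three summands.
  refine ⟨K + N + 2, ?_⟩
  filter_upwards [hK, hN, Filter.eventually_ge_atTop 2] with r h1 h2 hr w hw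
  have hr1 : (1 : ℝ) ≤ r := by linarith
  have a1 : Real.exp (r ^ K) ≤ Real.exp (r ^ (K + N)) :=
    Real.exp_le_exp.2 (pow_le_pow_right₀ hr1 (by omega))
  have a2 : Real.exp (r ^ N) ≤ Real.exp (r ^ (K + N)) :=
    Real.exp_le_exp.2 (pow_le_pow_right₀ hr1 (by omega))
  have a3 : 1 ≤ Real.exp (r ^ (K + N)) := Real.one_le_exp (by positivity)
  have a4 : (3 : ℝ) ≤ Real.exp 2 := by linarith [Real.add_one_le_exp (2 : ℝ)]
  have a5 : 2 + r ^ (K + N) ≤ r ^ (K + N + 2) := by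
    have : (1 : ℝ) ≤ r ^ (K + N) := one_le_pow₀ hr1
    have h4 : 4 ≤ r ^ 2 := by nlinarith
    rw [pow_add r (K + N) 2]
    nlinarith
  calc ‖g w‖ ≤ 1 + ‖u w‖ + ‖v w‖ := h w
    _ ≤ 3 * Real.exp (r ^ (K + N)) := by linarith [h1 w hw, h2 w hw]
    _ ≤ Real.exp 2 * Real.exp (r ^ (K + N)) := by gcongr
    _ = Real.exp (2 + r ^ (K + N)) := (Real.exp_add _ _).symm
    _ ≤ _ := Real.exp_le_exp.2 a5

/-! ### From finite order on `ℂ²` to growth along slices -/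

theorem norm_le_maxModulus {f : ℂ × ℂ → ℂ} (hf : Continuous f) {r : ℝ} {z : ℂ × ℂ}
    (hz : ‖z.1‖ ^ 2 + ‖z.2‖ ^ 2 ≤ r ^ 2) : ‖f z‖ ≤ maxModulus f r := by
  refine le_csSup ?_ ⟨z, hz, rfl⟩
  obtain ⟨C, hC⟩ := (isCompact_closedBall (0 : ℂ × ℂ) |r|).exists_bound_of_continuousOn
    hf.continuousOn
  refine ⟨C, ?_⟩
  rintro x ⟨y, hy, rfl⟩
  refine hC y ?_
  rw [mem_closedBall_zero_iff, Prod.norm_def, max_le_iff]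
  constructor <;> refine le_of_sq_le_sq ?_ (abs_nonneg _) <;> rw [sq_abs] <;>
    nlinarith [sq_nonneg ‖y.1‖, sq_nonneg ‖y.2‖]

theorem HasFiniteOrder.exists_norm_le {f : ℂ × ℂ → ℂ} (hf : Continuous f)
    (hord : HasFiniteOrder f) : ∃ K : ℕ, ∀ᶠ r : ℝ in Filter.atTop, ∀ z : ℂ × ℂ,
      ‖z.1‖ ^ 2 + ‖z.2‖ ^ 2 ≤ r ^ 2 → ‖f z‖ ≤ Real.exp (r ^ K) := by
  obtain ⟨x, hx1, hx2⟩ := EReal.lt_iff_exists_real_btwn.1 hord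
  obtain ⟨K, hK⟩ := exists_nat_ge x
  refine ⟨K, ?_⟩
  filter_upwards [Filter.eventually_lt_of_limsup_lt hx1, Filter.eventually_gt_atTop 1]
    with r hr hr1 z hz
  refine (norm_le_maxModulus hf hz).trans ?_
  set M := maxModulus f r
  have hlog : 0 < Real.log r := Real.log_pos hr1
  have h1 : Real.posLog (Real.posLog M) ≤ K * Real.log r := by
    have h := EReal.coe_lt_coe_iff.1 hr
    rw [div_lt_iff₀ hlog] at h
    exact h.le.trans (by gcongr)
  have h2 : Real.posLog M ≤ r ^ K := by
    rcases le_or_gt (Real.posLog M) 0 with h | h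
    · exact h.trans (by positivity)
    · rw [← Real.log_le_log_iff h (by positivity), Real.log_pow]
      exact (le_max_right _ _).trans h1
  have h3 : Real.log M ≤ r ^ K := (le_max_right _ _).trans h2
  rcases le_or_gt M 0 with h | h
  · exact h.trans (Real.exp_pos _).le
  · exact (Real.log_le_iff_le_exp h).1 h3

theorem HasFiniteOrder.hasExpGrowth_comp {f : ℂ × ℂ → ℂ} (hf : Continuous f)
    (hord : HasFiniteOrder f) {u : ℂ → ℂ × ℂ} {C : ℝ} (hu1 : ∀ w, ‖(u w).1‖ ≤ ‖w‖ + C)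
    (hu2 : ∀ w, ‖(u w).2‖ ≤ ‖w‖ + C) : HasExpGrowth (fun w => f (u w)) := by
  obtain ⟨K, hK⟩ := hord.exists_norm_le hf
  -- The image of the disc of radius `r` lies in the ball of radius `4r`, and `4r ≤ r ^ 3` once `r ≥
  -- 2`.
  refine ⟨3 * K, ?_⟩
  have h4 := (Filter.tendsto_id.const_mul_atTop (by norm_num : (0 : ℝ) < 4)).eventually hK
  filter_upwards [h4, Filter.eventually_ge_atTop 2, Filter.eventually_ge_atTop C]
    with r hr hr2 hC w hw
  refine (hr (u w) ?_).trans (Real.exp_le_exp.2 ?_)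
  · have h1 := (hu1 w).trans (by linarith : ‖w‖ + C ≤ 2 * r)
    have h2 := (hu2 w).trans (by linarith : ‖w‖ + C ≤ 2 * r)
    simp only [id]
    nlinarith [norm_nonneg (u w).1, norm_nonneg (u w).2]
  · rw [pow_mul]
    refine pow_le_pow_left₀ (by simp only [id]; linarith) ?_ K
    simp only [id]
    have : 4 ≤ r ^ 2 := by nlinarith
    nlinarith

/-! ### The Fermat equation in one variable -/

theorem Polynomial.exists_eq_C_of_derivative_eq_zero {p : Polynomial ℂ}
    (h : Polynomial.derivative p = 0) : ∃ k, p = Polynomial.C k :=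
  ⟨_, Polynomial.eq_C_of_natDegree_eq_zero (Polynomial.derivative_eq_zero.1 h)⟩

open Polynomial in
/-- If `derivative P * cosh P = i * cosh Q` for polynomials `P` and `Q`, then the derivative of `P`
is `0` or `± i`. -/
theorem derivative_eq_C_of_cosh_eq {P Q : ℂ[X]}
    (h : ∀ z, (derivative P).eval z * Complex.cosh (P.eval z)
      = Complex.I * Complex.cosh (Q.eval z)) :
    ∃ A : ℂ, (A = 0 ∨ A = 1 ∨ A = -1) ∧ derivative P = C (Complex.I * A) := by
  have h' : ∀ z, (derivative P).eval z * (Complex.exp (P.eval z) + Complex.exp (-P.eval z))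
      = Complex.I * (Complex.exp (Q.eval z) + Complex.exp (-Q.eval z)) := fun z => by
    have := h z
    simp only [Complex.cosh] at this
    linear_combination 2 * this
  by_cases hP : derivative P = 0
  · exact ⟨0, Or.inl rfl, by simp [hP]⟩
  have hP2 : derivative P + derivative P ≠ 0 := by
    rw [← two_mul]
    exact mul_ne_zero two_ne_zero hP
  -- Case `Q = ±P + const`: comparing the coefficients of `exp P` and `exp (-P)` gives `P' = i exp k
  -- = i exp (-k)`, so `exp k = ±1`.
  have two_terms : ∀ k : ℂ, (∀ z, Complex.exp (Q.eval z) + Complex.exp (-Q.eval z)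
      = Complex.exp k * Complex.exp (P.eval z) + Complex.exp (-k) * Complex.exp (-P.eval z)) →
      ∃ A : ℂ, (A = 0 ∨ A = 1 ∨ A = -1) ∧ derivative P = C (Complex.I * A) := by
    intro k hk
    have hB := eq_zero_of_sum_eval_mul_exp_eq_zero Finset.univ ![P, -P]
      (by
        intro i _ j _ hij
        fin_cases i <;> fin_cases j <;>
          simp [-derivative_eq_zero] at hij ⊢ <;> grind)
      ![derivative P - C (Complex.I * Complex.exp k),
        derivative P - C (Complex.I * Complex.exp (-k))]
      (fun z => by
        simp [Fin.sum_univ_two]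
        linear_combination h' z + Complex.I * hk z)
    have h0 : derivative P = C (Complex.I * Complex.exp k) := sub_eq_zero.1 (hB 0 (by simp))
    have h1 : derivative P = C (Complex.I * Complex.exp (-k)) := sub_eq_zero.1 (hB 1 (by simp))
    have h2 : Complex.exp k = Complex.exp (-k) :=
      mul_left_cancel₀ Complex.I_ne_zero (C_injective (h0.symm.trans h1))
    refine ⟨Complex.exp k, Or.inr (mul_self_eq_one_iff.1 ?_), h0⟩
    nth_rewrite 2 [h2]
    rw [← Complex.exp_add, add_neg_cancel, Complex.exp_zero]
  -- Unless `Q - P` or `Q + P` is constant, `exp P` stands apart from the other exponentials, so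
  -- Borel kills its coefficient `P'`, a contradiction.
  by_cases hQ : derivative Q = 0
  · obtain ⟨k, rfl⟩ := exists_eq_C_of_derivative_eq_zero hQ
    have hB := eq_zero_of_sum_eval_mul_exp_eq_zero Finset.univ ![P, -P, 0]
      (by
        intro i _ j _ hij
        fin_cases i <;> fin_cases j <;>
          simp [-derivative_eq_zero] at hij ⊢ <;> grind)
      ![derivative P, derivative P, -C (Complex.I * (Complex.exp k + Complex.exp (-k)))]
      (fun z => by
        have := h' z
        simp [Fin.sum_univ_three] at this ⊢
        linear_combination this)
    exact absurd (hB 0 (by simp)) hP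
  by_cases hPQ : derivative (Q - P) = 0
  · obtain ⟨k, hk⟩ := exists_eq_C_of_derivative_eq_zero hPQ
    refine two_terms k fun z => ?_
    rw [← Complex.exp_add, ← Complex.exp_add]
    have : Q.eval z = k + P.eval z := by
      rw [sub_eq_iff_eq_add.1 hk]
      simp
    rw [this, neg_add]
  by_cases hPQ' : derivative (Q + P) = 0
  · obtain ⟨k, hk⟩ := exists_eq_C_of_derivative_eq_zero hPQ'
    refine two_terms (-k) fun z => ?_
    rw [← Complex.exp_add, ← Complex.exp_add]
    have : Q.eval z = k - P.eval z := by
      rw [eq_sub_of_add_eq hk]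
      simp
    rw [this, add_comm]
    congr 2 <;> ring
  have hQ2 : derivative Q + derivative Q ≠ 0 := by
    rw [← two_mul]
    exact mul_ne_zero two_ne_zero hQ
  rw [derivative_sub] at hPQ
  rw [derivative_add] at hPQ'
  have hB := eq_zero_of_sum_eval_mul_exp_eq_zero Finset.univ ![P, -P, Q, -Q]
    (by
      intro i _ j _ hij
      fin_cases i <;> fin_cases j <;>
          simp [-derivative_eq_zero] at hij ⊢ <;> grind)
    ![derivative P, derivative P, -C Complex.I, -C Complex.I]
    (fun z => by
      simp [Fin.sum_univ_four]
      linear_combination h' z)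
  exact absurd (hB 0 (by simp)) hP

/-- Entire solutions of finite order of `u ^ 2 + v ^ 2 = 1` are parametrized by `cosh P` and
`-i sinh P` for a polynomial `P`. -/
theorem exists_polynomial_of_sq_add_sq_eq_one {u v : ℂ → ℂ} (hu : Differentiable ℂ u)
    (hv : Differentiable ℂ v) (hgr : HasExpGrowth v) (h : ∀ z, u z ^ 2 + v z ^ 2 = 1) :
    ∃ P : Polynomial ℂ, ∀ z, u z = Complex.cosh (P.eval z) ∧
      v z = -Complex.I * Complex.sinh (P.eval z) := by
  have hmul : ∀ z, (u z + Complex.I * v z) * (u z - Complex.I * v z) = 1 := fun z => by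
    linear_combination h z - v z ^ 2 * Complex.I_sq
  have hu_le : ∀ z, ‖u z‖ ≤ 1 + ‖v z‖ := fun z => by
    have : ‖u z‖ ^ 2 ≤ 1 + ‖v z‖ ^ 2 := by
      rw [← norm_pow, ← norm_pow, eq_sub_of_add_eq (h z)]
      exact (norm_sub_le _ _).trans (by simp)
    nlinarith [norm_nonneg (v z), norm_nonneg (u z)]
  obtain ⟨P, hP⟩ := HasExpGrowth.exists_eq_exp_polynomial
    (g := fun z => u z + Complex.I * v z) (by fun_prop)
    (fun z => left_ne_zero_of_mul_eq_one (hmul z))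
    (hgr.of_norm_le hgr fun z => by
      refine (norm_add_le _ _).trans ?_
      rw [norm_mul, Complex.norm_I, one_mul]
      linarith [hu_le z])
  refine ⟨P, fun z => ?_⟩
  have h1 := hP z
  have h2 : u z - Complex.I * v z = Complex.exp (-P.eval z) := by
    rw [Complex.exp_neg, ← h1]
    exact eq_inv_of_mul_eq_one_right (hmul z)
  rw [Complex.cosh, Complex.sinh, ← h1, ← h2]
  constructor
  · ring
  · linear_combination v z * Complex.I_sq

theorem exists_eq_cosh_sinh_of_fermat {φ ψ χ : ℂ → ℂ} (hφ : Differentiable ℂ φ)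
    (hψ : Differentiable ℂ ψ) (hχ : Differentiable ℂ χ) (hψg : HasExpGrowth ψ)
    (hχg : HasExpGrowth χ) (h1 : ∀ z, deriv φ z ^ 2 + ψ z ^ 2 = 1)
    (h2 : ∀ z, deriv ψ z ^ 2 + χ z ^ 2 = 1) :
    ∃ A b : ℂ, (A = 0 ∨ A = 1 ∨ A = -1) ∧ ∀ z, deriv φ z = Complex.cosh (Complex.I * A * z + b) ∧
      ψ z = -Complex.I * Complex.sinh (Complex.I * A * z + b) := by
  obtain ⟨P, hP⟩ := exists_polynomial_of_sq_add_sq_eq_one hφ.deriv hψ hψg h1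
  obtain ⟨Q, hQ⟩ := exists_polynomial_of_sq_add_sq_eq_one hψ.deriv hχ hχg h2
  obtain ⟨A, hA, hPA⟩ := derivative_eq_C_of_cosh_eq (P := P) (Q := Q) fun z => by
    have hd : HasDerivAt ψ (-Complex.I * (Complex.cosh (P.eval z) *
        (Polynomial.derivative P).eval z)) z := by
      rw [show ψ = fun z => -Complex.I * Complex.sinh (P.eval z) from funext fun z => (hP z).2]
      exact (P.hasDerivAt z).csinh.const_mul _
    have := hd.deriv
    rw [(hQ z).1] at this
    rw [this]
    linear_combination ((Polynomial.derivative P).eval z * Complex.cosh (P.eval z)) * Complex.I_sq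
  obtain ⟨b, hb⟩ := Polynomial.exists_eq_C_of_derivative_eq_zero
    (p := P - Polynomial.C (Complex.I * A) * Polynomial.X) (by simp [hPA])
  refine ⟨A, b, hA, fun z => ?_⟩
  have : P.eval z = Complex.I * A * z + b := by
    rw [sub_eq_iff_eq_add.1 hb]
    simp [add_comm]
  rw [← this]
  exact hP z

/-! ### Connectedness, shifts of `sinh` and `cosh`, polynomials under translation -/

theorem forall_or_forall_of_isClosed {p q : ℂ → Prop} (hp : IsClosed {w | p w})
    (hq : IsClosed {w | q w}) (h : ∀ w, p w ∨ q w) (hpq : ∀ w, p w → ¬ q w) :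
    (∀ w, p w) ∨ ∀ w, q w := by
  by_contra! hcon
  obtain ⟨⟨x, hx⟩, y, hy⟩ := hcon
  obtain ⟨w, -, hw⟩ := isPreconnected_closed_iff.1 (isPreconnected_univ (α := ℂ)) _ _ hp hq
    (fun w _ => h w) ⟨y, trivial, (h y).resolve_right hy⟩ ⟨x, trivial, (h x).resolve_left hx⟩
  exact hpq w hw.1 hw.2

theorem sinh_add_I_mul_pi_div_two {A : ℂ} (hA : A = 1 ∨ A = -1) (x : ℂ) :
    Complex.sinh (x + Complex.I * A * (Real.pi / 2)) = Complex.I * A * Complex.cosh x := by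
  have e : Complex.I * A * (Real.pi / 2) = (A * (Real.pi / 2)) * Complex.I := by ring
  rw [Complex.sinh_add, e, Complex.sinh_mul_I, Complex.cosh_mul_I]
  rcases hA with rfl | rfl <;> simp <;> ring

theorem cosh_add_I_mul_pi_div_two {A : ℂ} (hA : A = 1 ∨ A = -1) (x : ℂ) :
    Complex.cosh (x + Complex.I * A * (Real.pi / 2)) = Complex.I * A * Complex.sinh x := by
  have e : Complex.I * A * (Real.pi / 2) = (A * (Real.pi / 2)) * Complex.I := by ring
  rw [Complex.cosh_add, e, Complex.sinh_mul_I, Complex.cosh_mul_I]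
  rcases hA with rfl | rfl <;> simp <;> ring

theorem sinh_add_I_mul_pi {A : ℂ} (hA : A = 1 ∨ A = -1) (x : ℂ) :
    Complex.sinh (x + Complex.I * A * Real.pi) = -Complex.sinh x := by
  have e : x + Complex.I * A * Real.pi
      = (x + Complex.I * A * (Real.pi / 2)) + Complex.I * A * (Real.pi / 2) := by ring
  rw [e, sinh_add_I_mul_pi_div_two hA, cosh_add_I_mul_pi_div_two hA]
  rcases hA with rfl | rfl <;> linear_combination Complex.sinh x * Complex.I_sq

open Polynomial in
/-- A polynomial whose difference with a nontrivial translate is constant is affine. -/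
theorem exists_eq_affine_of_translate {g : ℂ[X]} {c k : ℂ} (hc : c ≠ 0)
    (h : ∀ z, g.eval (z + c) - g.eval z = k) : ∃ B D : ℂ, g = C B * X + C D := by
  have hper : ∀ z, (derivative g).eval (z + c) = (derivative g).eval z := by
    have : g.comp (X + C c) - g = C k := Polynomial.funext fun z => by simpa using h z
    intro z
    have := congrArg (fun p => (derivative p).eval z) this
    simpa [derivative_comp, sub_eq_zero] using this
  -- The derivative is `c`-periodic, so it takes one value at infinitely many points and is
  -- constant.
  have hn : ∀ n : ℕ, (derivative g).eval (n * c) = (derivative g).eval 0 := by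
    intro n
    induction n with
    | zero => simp
    | succ n ih => rw [← ih, ← hper (n * c)]; push_cast; ring_nf
  have hd : derivative g = C ((derivative g).eval 0) := by
    refine eq_of_infinite_eval_eq _ _ (Set.infinite_of_injective_forall_mem
      (f := fun n : ℕ => (n : ℂ) * c) (fun m n hmn => ?_) fun n => ?_)
    · exact_mod_cast mul_right_cancel₀ hc hmn
    · simpa using hn n
  obtain ⟨D, hD⟩ := exists_eq_C_of_derivative_eq_zero
    (p := g - C ((derivative g).eval 0) * X) (by
      rw [derivative_sub, derivative_C_mul, derivative_X, mul_one]
      exact sub_eq_zero.2 hd)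
  exact ⟨(derivative g).eval 0, D, by rw [← hD]; ring⟩

open Polynomial in
theorem exists_eq_C_of_exp_eval_eq {D : ℂ[X]} {A : ℂ}
    (h : ∀ z, Complex.exp (D.eval z) = A) : ∃ l, D = C l := by
  refine exists_eq_C_of_derivative_eq_zero (Polynomial.funext fun z => ?_)
  have h1 := (D.hasDerivAt z).cexp
  rw [funext h] at h1
  simpa [Complex.exp_ne_zero] using h1.unique (hasDerivAt_const z A)

/-! ### The slices of a solution -/

open Complex in
theorem fermat_slices {c₁ c₂ : ℂ} {f : ℂ × ℂ → ℂ} (hf : Differentiable ℂ f)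
    (hord : HasFiniteOrder f)
    (heq : ∀ z₁ z₂ : ℂ, partialFst f z₁ z₂ ^ 2 + f (z₁ + c₁, z₂ + c₂) ^ 2 = 1) (z₂ : ℂ) :
    ∃ A b : ℂ, (A = 0 ∨ A = 1 ∨ A = -1) ∧ ∀ z₁, partialFst f z₁ z₂ = cosh (I * A * z₁ + b) ∧
      f (z₁ + c₁, z₂ + c₂) = -I * sinh (I * A * z₁ + b) := by
  have hgr : ∀ a w, HasExpGrowth (fun z => f (z + a, w)) := fun a w =>
    hord.hasExpGrowth_comp (C := ‖a‖ + ‖w‖) hf.continuous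
      (fun z => (norm_add_le z a).trans (by linarith [norm_nonneg w]))
      (fun z => by simp only; linarith [norm_nonneg z, norm_nonneg a])
  refine exists_eq_cosh_sinh_of_fermat (φ := fun z => f (z, z₂))
    (χ := fun z => f (z + (c₁ + c₁), z₂ + c₂ + c₂)) (by fun_prop) (by fun_prop) (by fun_prop)
    (hgr _ _) (hgr _ _) (fun z => heq z z₂) fun z => ?_
  rw [deriv_comp_add_const (fun z => f (z, z₂ + c₂)), ← add_assoc]
  exact heq _ _

-- Holds for all three values of `A`, so it is available before `A = 0` is analysed, and is what
-- excludes nonconstant affine slices there.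
open Complex in
theorem fermat_periodic {c₁ c₂ : ℂ} {f : ℂ × ℂ → ℂ} (hf : Differentiable ℂ f)
    (hord : HasFiniteOrder f)
    (heq : ∀ z₁ z₂ : ℂ, partialFst f z₁ z₂ ^ 2 + f (z₁ + c₁, z₂ + c₂) ^ 2 = 1) (z w : ℂ) :
    f (z + Real.pi + Real.pi, w) = f (z, w) := by
  obtain ⟨A, b, hA, h⟩ := fermat_slices hf hord heq (w - c₂)
  have h' : ∀ z, f (z, w) = -I * sinh (I * A * (z - c₁) + b) := fun z => by
    simpa using (h (z - c₁)).2
  rw [h', h']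
  rcases hA with rfl | hA
  · simp
  · rw [show I * A * (z + Real.pi + Real.pi - c₁) + b
      = I * A * (z - c₁) + b + I * A * Real.pi + I * A * Real.pi by ring,
      sinh_add_I_mul_pi hA, sinh_add_I_mul_pi hA, neg_neg]

open Complex in
/-- On each slice, a solution is either a constant `± 1` or a sinusoid of frequency `1`. -/
theorem fermat_slice_const_or_sinh {c₁ c₂ : ℂ} {f : ℂ × ℂ → ℂ} (hf : Differentiable ℂ f)
    (hord : HasFiniteOrder f)
    (heq : ∀ z₁ z₂ : ℂ, partialFst f z₁ z₂ ^ 2 + f (z₁ + c₁, z₂ + c₂) ^ 2 = 1) (w : ℂ) :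
    (∃ ε : ℂ, (ε = 1 ∨ ε = -1) ∧ ∀ z, f (z, w) = ε) ∨
      ∃ A b : ℂ, (A = 1 ∨ A = -1) ∧ ∀ z, f (z, w) = -I * sinh (I * A * z + b) := by
  obtain ⟨A, b, hA, h⟩ := fermat_slices hf hord heq (w - c₂)
  have h' : ∀ z, f (z, w) = -I * sinh (I * A * (z - c₁) + b) := fun z => by
    simpa using (h (z - c₁)).2
  rcases hA with rfl | hA
  · left
    refine ⟨-I * sinh b, ?_, fun z => by simp [h']⟩
    -- The slice at `w - c₂` is affine with slope `cosh b`; its values at `0` and `2π` agree, so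
    -- `cosh b = 0` and `(-i sinh b) ^ 2 = 1`.
    have hd : ∀ z, HasDerivAt (fun z => f (z, w - c₂) - cosh b * z) 0 z := fun z => by
      have h1 : HasDerivAt (fun z => f (z, w - c₂)) (partialFst f z (w - c₂)) z :=
        DifferentiableAt.hasDerivAt (by fun_prop)
      rw [(h z).1] at h1
      simpa using h1.fun_sub ((hasDerivAt_id z).const_mul (cosh b))
    have hconst := is_const_of_deriv_eq_zero (fun z => (hd z).differentiableAt)
      (fun z => (hd z).deriv) (0 + Real.pi + Real.pi) 0
    simp only [fermat_periodic hf hord heq] at hconst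
    have hcosh : cosh b = 0 := by
      have hpi : (Real.pi : ℂ) ≠ 0 := by exact_mod_cast Real.pi_ne_zero
      have : cosh b * (2 * Real.pi) = 0 := by linear_combination -hconst
      simpa [hpi] using this
    rw [← mul_self_eq_one_iff]
    linear_combination sinh b ^ 2 * I_sq + cosh_sq_sub_sinh_sq b - cosh b * hcosh
  · right
    exact ⟨A, b - I * A * c₁, hA, fun z => by rw [h']; congr 2; ring⟩

-- Makes opposite sign rules on a slice, such as `f = g` and `f = -g`, incompatible; this is the
-- disjointness that the connectedness arguments need.
open Complex in
theorem fermat_slice_ne_zero {c₁ c₂ : ℂ} {f : ℂ × ℂ → ℂ} (hf : Differentiable ℂ f)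
    (hord : HasFiniteOrder f)
    (heq : ∀ z₁ z₂ : ℂ, partialFst f z₁ z₂ ^ 2 + f (z₁ + c₁, z₂ + c₂) ^ 2 = 1) (w : ℂ) :
    ∃ z, f (z, w) ≠ 0 := by
  rcases fermat_slice_const_or_sinh hf hord heq w with ⟨ε, hε, h⟩ | ⟨A, b, hA, h⟩
  · exact ⟨0, by rw [h]; rcases hε with rfl | rfl <;> simp⟩
  · by_contra! h0
    have h1 := h0 0
    have h2 := h0 (Real.pi / 2)
    rw [h, mul_zero, zero_add] at h1
    rw [h, add_comm, sinh_add_I_mul_pi_div_two hA] at h2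
    have hs : sinh b = 0 := by simpa using h1
    have hc : cosh b = 0 := by
      rcases hA with rfl | rfl <;> simpa using h2
    have := cosh_sq_sub_sinh_sq b
    simp [hs, hc] at this

open Complex in
/-- A transcendental solution is a sinusoid on every slice, so it changes sign under
`z₁ ↦ z₁ + π`. -/
theorem fermat_antiperiodic {c₁ c₂ : ℂ} {f : ℂ × ℂ → ℂ} (hf : IsTranscendentalEntire f)
    (hord : HasFiniteOrder f)
    (heq : ∀ z₁ z₂ : ℂ, partialFst f z₁ z₂ ^ 2 + f (z₁ + c₁, z₂ + c₂) ^ 2 = 1) (z w : ℂ) :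
    f (z + Real.pi, w) = -f (z, w) := by
  obtain ⟨hf, htr⟩ := hf
  have hc := hf.continuous
  have hne := fermat_slice_ne_zero hf hord heq
  have hdich := fermat_slice_const_or_sinh hf hord heq
  have hanti : ∀ w A b : ℂ, (A = 1 ∨ A = -1) → (∀ z, f (z, w) = -I * sinh (I * A * z + b)) →
      ∀ z, f (z + Real.pi, w) = -f (z, w) := fun w A b hA h z => by
    rw [h, h, mul_add, add_right_comm, sinh_add_I_mul_pi hA, mul_neg]
  have hexcl : ∀ w, (∀ z, f (z + Real.pi, w) = f (z, w)) →
      ¬ ∀ z, f (z + Real.pi, w) = -f (z, w) := fun w h1 h2 => by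
    obtain ⟨z, hz⟩ := hne w
    exact hz (self_eq_neg.1 ((h1 z).symm.trans (h2 z)))
  rcases forall_or_forall_of_isClosed (p := fun w => ∀ z, f (z + Real.pi, w) = f (z, w))
    (q := fun w => ∀ z, f (z + Real.pi, w) = -f (z, w))
    (by
      simp only [Set.ofPred_forall]
      exact isClosed_iInter fun z => isClosed_eq (by fun_prop) (by fun_prop))
    (by
      simp only [Set.ofPred_forall]
      exact isClosed_iInter fun z => isClosed_eq (by fun_prop) (by fun_prop))
    (fun w => by
      rcases hdich w with ⟨ε, hε, h⟩ | ⟨A, b, hA, h⟩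
      · exact Or.inl fun z => by rw [h, h]
      · exact Or.inr (hanti w A b hA h)) hexcl with hper | hq
  · have hconst : ∀ w, ∃ ε : ℂ, (ε = 1 ∨ ε = -1) ∧ ∀ z, f (z, w) = ε := fun w =>
      (hdich w).resolve_right fun ⟨A, b, hA, h⟩ => hexcl w (hper w) (hanti w A b hA h)
    have hslice : ∀ z w, f (z, w) = f (0, w) := fun z w => by
      obtain ⟨ε, -, h⟩ := hconst w
      rw [h, h]
    refine absurd ?_ htr
    rcases forall_or_forall_of_isClosed (p := fun w => f (0, w) = 1) (q := fun w => f (0, w) = -1)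
      (isClosed_eq (by fun_prop) (by fun_prop)) (isClosed_eq (by fun_prop) (by fun_prop))
      (fun w => by
        obtain ⟨ε, hε, h⟩ := hconst w
        rwa [h])
      (fun w h1 h2 => by
        rw [h1] at h2
        norm_num at h2) with h | h
    · exact ⟨MvPolynomial.C 1, fun z w => by rw [hslice, h]; simp⟩
    · exact ⟨MvPolynomial.C (-1), fun z w => by rw [hslice, h]; simp⟩
  · exact hq w z

open Complex in
theorem fermat_eq_mul_translate {c₁ c₂ : ℂ} {f : ℂ × ℂ → ℂ} (hf : IsTranscendentalEntire f)
    (hord : HasFiniteOrder f)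
    (heq : ∀ z₁ z₂ : ℂ, partialFst f z₁ z₂ ^ 2 + f (z₁ + c₁, z₂ + c₂) ^ 2 = 1) :
    ∃ A : ℂ, (A = 1 ∨ A = -1) ∧ (∀ z₁ z₂, f (z₁, z₂) = A * f (z₁ + c₁, z₂ + c₂)) ∧
      ∀ z₂, ∃ b, ∀ z₁, f (z₁, z₂) = A * (-I * sinh (I * A * z₁ + b)) := by
  have hanti := fermat_antiperiodic hf hord heq
  have hne := fermat_slice_ne_zero hf.1 hord heq
  have hd := hf.1
  have hc := hd.continuous
  have key : ∀ z₂, ∃ A b : ℂ, (A = 1 ∨ A = -1) ∧ ∀ z₁,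
      f (z₁ + c₁, z₂ + c₂) = -I * sinh (I * A * z₁ + b) ∧
      f (z₁, z₂) = A * f (z₁ + c₁, z₂ + c₂) := by
    intro z₂
    obtain ⟨A, b, hA, h⟩ := fermat_slices hd hord heq z₂
    rcases hA with rfl | hA
    · obtain ⟨z, hz⟩ := hne (z₂ + c₂)
      have e : ∀ z, f (z, z₂ + c₂) = -I * sinh b := fun z => by
        simpa using (h (z - c₁)).2
      have := hanti z (z₂ + c₂)
      rw [e, e, self_eq_neg, ← e z] at this
      exact absurd this hz
    · refine ⟨A, b, hA, fun z => ⟨(h z).2, ?_⟩⟩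
      have hA2 : A * A = 1 := mul_self_eq_one_iff.2 hA
      have hD : ∀ z, HasDerivAt (fun z => f (z, z₂) - A * f (z + c₁, z₂ + c₂)) 0 z := fun z => by
        have h1 : HasDerivAt (fun z => f (z, z₂)) (partialFst f z z₂) z :=
          DifferentiableAt.hasDerivAt (by fun_prop)
        have h2 : HasDerivAt (fun z => f (z + c₁, z₂ + c₂))
            (-I * (cosh (I * A * z + b) * (I * A))) z := by
          rw [show (fun z => f (z + c₁, z₂ + c₂)) = fun z => -I * sinh (I * A * z + b) from
            funext fun z => (h z).2]
          refine HasDerivAt.const_mul _ (HasDerivAt.csinh ?_)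
          simpa using ((hasDerivAt_id z).const_mul (I * A)).add_const b
        rw [(h z).1] at h1
        convert! h1.sub (h2.const_mul A) using 1
        linear_combination cosh (I * A * z + b) * hA2 + A * A * cosh (I * A * z + b) * (-I_sq)
      -- The difference is constant in `z₁` and changes sign under `z₁ ↦ z₁ + π`, hence is zero.
      have := is_const_of_deriv_eq_zero (fun z => (hD z).differentiableAt)
        (fun z => (hD z).deriv) (z + Real.pi) z
      simp only [add_right_comm _ (Real.pi : ℂ), hanti] at this
      linear_combination (-1 / 2) * this
  have hcl : ∀ A : ℂ, IsClosed {z₂ | ∀ z₁, f (z₁, z₂) = A * f (z₁ + c₁, z₂ + c₂)} := fun A => by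
    simp only [Set.ofPred_forall]
    exact isClosed_iInter fun z => isClosed_eq (by fun_prop) (by fun_prop)
  have hglob : ∃ A : ℂ, (A = 1 ∨ A = -1) ∧ ∀ z₂ z₁, f (z₁, z₂) = A * f (z₁ + c₁, z₂ + c₂) := by
    rcases forall_or_forall_of_isClosed (hcl 1) (hcl (-1))
      (fun w => by
        obtain ⟨A, b, rfl | rfl, h⟩ := key w
        · exact Or.inl fun z => (h z).2
        · exact Or.inr fun z => (h z).2)
      (fun w h1 h2 => by
        obtain ⟨z, hz⟩ := hne w
        have e1 := h1 z
        have e2 := h2 z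
        exact hz (by linear_combination (e1 + e2) / 2)) with h | h
    · exact ⟨1, Or.inl rfl, h⟩
    · exact ⟨-1, Or.inr rfl, h⟩
  obtain ⟨A, hA, hglob⟩ := hglob
  refine ⟨A, hA, fun z₁ z₂ => hglob z₂ z₁, fun z₂ => ?_⟩
  obtain ⟨A', b, -, h⟩ := key z₂
  obtain ⟨z, hz⟩ := hne z₂
  have hAA : A = A' := by
    have e1 := hglob z₂ z
    have e2 := (h z).2
    refine mul_right_cancel₀ (fun h0 => hz ?_) (e1.symm.trans e2)
    rw [e1, h0, mul_zero]
  subst hAA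
  exact ⟨b, fun z₁ => by rw [← (h z₁).1, ← (h z₁).2]⟩

open Complex in
/-- Exponential form of a solution: the phase is linear in `z₁` and a polynomial `g` in `z₂`. -/
theorem fermat_exp_form {c₁ c₂ : ℂ} {f : ℂ × ℂ → ℂ} (hf : IsTranscendentalEntire f)
    (hord : HasFiniteOrder f)
    (heq : ∀ z₁ z₂ : ℂ, partialFst f z₁ z₂ ^ 2 + f (z₁ + c₁, z₂ + c₂) ^ 2 = 1) :
    ∃ (A l : ℂ) (g : Polynomial ℂ), A * A = 1 ∧
      (∀ z₁ z₂, f (z₁, z₂)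
        = A / (2 * I) * (exp (I * A * z₁ + g.eval z₂) - exp (-(I * A * z₁ + g.eval z₂)))) ∧
      exp l = A ∧ ∀ z₂, g.eval (z₂ + c₂) - g.eval z₂ + I * A * c₁ = l := by
  obtain ⟨A, hA, htrans, hform⟩ := fermat_eq_mul_translate hf hord heq
  have hA2 : A * A = 1 := mul_self_eq_one_iff.2 hA
  choose b hb using hform
  -- A quarter-period shift turns `sinh` into `cosh`, isolating one exponential. The left side is
  -- entire in `z₂`, although `b` is only chosen pointwise.
  have hexp : ∀ z₁ z₂, f (z₁ + Real.pi / 2, z₂) + I * A * f (z₁, z₂)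
      = exp (I * A * z₁ + b z₂) := fun z₁ z₂ => by
    rw [hb, hb, mul_add, add_right_comm, sinh_add_I_mul_pi_div_two hA, ← cosh_add_sinh]
    linear_combination (-(A * A) * cosh (I * A * z₁ + b z₂)
      - A * A * sinh (I * A * z₁ + b z₂)) * I_sq
      + (cosh (I * A * z₁ + b z₂) + sinh (I * A * z₁ + b z₂)) * hA2
  have hd := hf.1
  have hgr : ∀ a, HasExpGrowth (fun z => f (a, z)) := fun a =>
    hord.hasExpGrowth_comp (C := ‖a‖) hd.continuous
      (fun z => by simp only; linarith [norm_nonneg z])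
      (fun z => by simp only; linarith [norm_nonneg a])
  obtain ⟨g, hg⟩ := HasExpGrowth.exists_eq_exp_polynomial
    (g := fun z => f (0 + Real.pi / 2, z) + I * A * f (0, z)) (by fun_prop)
    (fun z => by rw [hexp]; exact exp_ne_zero _)
    ((hgr (0 + Real.pi / 2)).of_norm_le (hgr 0) fun z => by
      refine (norm_add_le _ _).trans ?_
      have : ‖A‖ = 1 := by rcases hA with rfl | rfl <;> simp
      rw [norm_mul, norm_mul, norm_I, this]
      linarith)
  have hbg : ∀ z, exp (b z) = exp (g.eval z) := fun z => by
    have := hg z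
    simp only [hexp] at this
    simpa using this
  have hl : ∀ z, exp ((g.comp (Polynomial.X + Polynomial.C c₂) - g
      + Polynomial.C (I * A * c₁)).eval z) = A := fun z => by
    have h1 := hexp 0 z
    rw [htrans, htrans 0, add_right_comm, mul_left_comm, ← mul_add, hexp, zero_add, mul_zero,
      zero_add, exp_add, hbg, hbg] at h1
    have h2 := exp_ne_zero (g.eval z)
    simp only [Polynomial.eval_add, Polynomial.eval_sub, Polynomial.eval_comp, Polynomial.eval_X,
      Polynomial.eval_C]
    rw [exp_add, exp_sub, div_mul_eq_mul_div, div_eq_iff h2, ← h1]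
    linear_combination (-exp (I * A * c₁) * exp (g.eval (z + c₂))) * hA2
  obtain ⟨l, hl'⟩ := exists_eq_C_of_exp_eval_eq hl
  refine ⟨A, l, g, hA2, fun z₁ z₂ => ?_, ?_, fun z₂ => ?_⟩
  · have hI : A / (2 * I) = -(A * I) / 2 := by
      rw [div_mul_eq_div_div, div_I]
      ring
    rw [hb, hI, sinh, exp_neg, exp_neg, exp_add, exp_add, hbg]
    ring
  · rw [← hl 0, hl', Polynomial.eval_C]
  · simpa using congrArg (Polynomial.eval z₂) hl'

theorem theorem1p3 (c₁ c₂ : ℂ) (f : ℂ × ℂ → ℂ)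
    (hf : IsTranscendentalEntire f) (hord : HasFiniteOrder f)
    (heq : ∀ z₁ z₂ : ℂ, partialFst f z₁ z₂ ^ 2 + f (z₁ + c₁, z₂ + c₂) ^ 2 = 1) :
    ∃ (A B α β₁ β₂ : ℂ) (h : Polynomial ℂ),
      A ^ 2 = 1 ∧ α ≠ 0 ∧ β₁ * β₂ = 1 ∧
      (∀ z₁ z₂ : ℂ, f (z₁, z₂) = A / (2 * Complex.I) *
        (β₁ * Complex.exp (α * (Complex.I / α * A * z₁ + B * z₂ + h.eval z₂))
          - β₂ * Complex.exp (-α * (Complex.I / α * A * z₁ + B * z₂ + h.eval z₂)))) ∧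
      (∃ l : ℂ, Complex.exp l = A ∧
        ∀ z₂ : ℂ, h.eval z₂ - h.eval (z₂ + c₂) =
          Complex.I / α * A * c₁ + B * c₂ + 1 / α * l) ∧
      A * Complex.exp (Complex.I * A * c₁ + α * B * c₂) = 1 ∧
      (c₂ ≠ 0 → ∃ C : ℂ, h = Polynomial.C C ∧
        ∀ z₁ z₂ : ℂ, f (z₁, z₂) = A / (2 * Complex.I) *
          (β₁ * Complex.exp (α * (Complex.I / α * A * z₁ + B * z₂ + C))
            - β₂ * Complex.exp (-α * (Complex.I / α * A * z₁ + B * z₂ + C)))) := by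
  obtain ⟨A, l, g, hA, hform, hl, hg⟩ := fermat_exp_form hf hord heq
  -- The required difference `h(z₂) - h(z₂ + c₂)` has the opposite sign to that of `g`, so `-l`
  -- serves as `log A`; this is allowed since `A⁻¹ = A`.
  have hl' : Complex.exp (-l) = A := by
    rw [Complex.exp_neg, hl]
    exact inv_eq_of_mul_eq_one_left hA
  rcases eq_or_ne c₂ 0 with rfl | hc
  · have hlc : l = Complex.I * A * c₁ := by simpa using (hg 0).symm
    refine ⟨A, 0, 1, 1, 1, g, by rw [sq, hA], one_ne_zero, one_mul 1, fun z₁ z₂ => ?_,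
      ⟨-l, hl', fun z₂ => by simp [hlc]⟩, ?_, fun h => absurd rfl h⟩
    · rw [hform]
      simp
    · rw [mul_zero, add_zero, ← hlc, hl, hA]
  -- The slope of the affine `g` becomes `B`, its constant term becomes `h`, and `α = β₁ = β₂ = 1`.
  · obtain ⟨B, D, rfl⟩ := exists_eq_affine_of_translate (k := l - Complex.I * A * c₁) hc
      fun z => by linear_combination hg z
    have hB : Complex.I * A * c₁ + B * c₂ = l := by
      have := hg 0
      simp at this
      linear_combination this
    have hform' : ∀ z₁ z₂ : ℂ, f (z₁, z₂) = A / (2 * Complex.I) *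
        (1 * Complex.exp (1 * (Complex.I / 1 * A * z₁ + B * z₂ + D))
          - 1 * Complex.exp (-1 * (Complex.I / 1 * A * z₁ + B * z₂ + D))) := fun z₁ z₂ => by
      rw [hform]
      simp [add_assoc]
    refine ⟨A, B, 1, 1, 1, Polynomial.C D, by rw [sq, hA], one_ne_zero, one_mul 1,
      fun z₁ z₂ => by rw [Polynomial.eval_C]; exact hform' z₁ z₂,
      ⟨-l, hl', fun z₂ => ?_⟩, ?_, fun _ => ⟨D, rfl, hform'⟩⟩
    · simp only [Polynomial.eval_C]
      linear_combination -hB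
    · rw [one_mul, hB, hl, hA]
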